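/- \textbf{Definitions.} An \emph{additively idempotent semifield} is a commutative semiring $(S,+,\cdot,0,1)$ with $0\neq 1$ in which every nonzero element is invertible and $x+x=x$ for all $x$; morphisms are semiring homomorphisms (preserving $+,\cdot,0,1$). For such $S$ let $\mathrm{Detrop}(S)$ be the abelian $\ell$-group $(S\setminus\{0\},\cdot,1)$ ordered by $x\le y\iff x+y=y$; a morphism is sent to its restriction. Morphisms of abelian $\ell$-groups are group homomorphisms preserving $\wedge$ and $\vee$. An \emph{MV-algebra} is a structure $(A,\oplus,\neg,0,1)$ such that $(A,\oplus,0)$ is a commutative monoid, $\neg 0=1$, $x\oplus 1=1$, $\neg\neg x=x$ and $\neg(\neg x\oplus y)\oplus y=\neg(\neg y\oplus x)\oplus x$; it is a lattice under $x\le y\iff\exists z\;(y=x\oplus z)$, and $x\odot y=\neg(\neg x\oplus\neg y)$. An element $x$ is \emph{infinitesimal} if $nx\le\neg x$ for all integers $n\ge 1$. $A$ is \emph{perfect} if it is the disjoint union of its set $\mathrm{Rad}(A)$ of infinitesimals and the set of negations of infinitesimals. Let $PERF$ be the category of perfect MV-algebras and MV-homomorphisms. For an abelian $\ell$-group $G$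 let $\Delta(G)\in PERF$ be the interval $[(0,0),(1,0)]$ of the lexicographic product $\mathbb Z\times_{\mathrm{lex}}G$, with $x\oplus y=(x+y)\wedge(1,0)$ and $\neg x=(1,0)-x$; a homomorphism $f$ is sent to $(n,g)\mapsto(n,f(g))$. Let $TOP$ be the category whose objects are the lattice-ordered commutative monoids with top isomorphic to $G^+\cup\{\top\}$ for some abelian $\ell$-group $G$, where $G^+=\{g\in G: g\ge 0\}$ and $\top$ is an adjoined greatest element with $\top+x=\top$ for all $x$. The elements other than $\top$ form the positive cone of the object. Morphisms are the maps preserving $+$, $0$, $\wedge$, $\vee$, mapping the positive cone into the positive cone, and mapping $\top$ to $\top$. For $A\in PERF$ let $\theta(A)=\{x\in A: x\ge 2x^2\}$, where $x^2=x\odot x$ and $2y=y\oplus y$, with the operations $\oplus,0,\wedge,\vee$ and the top element $1$ inherited from $A$; this is an object of $TOP$, and $\theta$ sends an MV-homomorphism to its restriction. \textbf{Theorem.} The composite functor $\mathbf F(S)=\theta(\Delta(\mathrm{Detrop}(S)))$ is an equivalence of categories from the category of additively idempotent semifields to $TOP$. -/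

import Mathlib

open CategoryTheory

universe u

/-! ## Additively idempotent semifields -/

/-- The category of additively idempotent semifields; its morphisms are the homomorphisms of
semirings (preserving `+`, `*`, `0` and `1`). -/
structure IdemSemifield : Type (u + 1) where
  carrier : Type u
  [semifield : Semifield carrier]
  add_self : ∀ x : carrier, x + x = x

namespace IdemSemifield

instance : CoeSort IdemSemifield.{u} (Type u) := ⟨carrier⟩

attribute [instance] semifield

instance : Category IdemSemifield.{u} where
  Hom S T := S →+* T
  id S := RingHom.id S
  comp f g := g.comp f

end IdemSemifield

/-! ## Abelian lattice-ordered groups -/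

/-- The category of abelian lattice-ordered groups. -/
structure AbLatGroup : Type (u + 1) where
  carrier : Type u
  [addCommGroup : AddCommGroup carrier]
  [lattice : Lattice carrier]
  [isOrderedAddMonoid : IsOrderedAddMonoid carrier]

/-- Homomorphisms of abelian lattice-ordered groups: group homomorphisms that preserve binary
suprema and infima. -/
@[ext]
structure LatGroupHom (G H : Type*) [AddCommGroup G] [Lattice G] [AddCommGroup H] [Lattice H]
    extends G →+ H where
  map_sup' : ∀ x y : G, toFun (x ⊔ y) = toFun x ⊔ toFun y
  map_inf' : ∀ x y : G, toFun (x ⊓ y) = toFun x ⊓ toFun y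

namespace LatGroupHom

variable {G H K : Type*} [AddCommGroup G] [Lattice G] [AddCommGroup H] [Lattice H]
  [AddCommGroup K] [Lattice K]

instance : FunLike (LatGroupHom G H) G H where
  coe f := f.toFun
  coe_injective _ _ h := LatGroupHom.ext h

protected theorem map_zero (f : LatGroupHom G H) : f 0 = 0 := f.map_zero'
protected theorem map_add (f : LatGroupHom G H) (x y : G) : f (x + y) = f x + f y := f.map_add' x y
protected theorem map_sub (f : LatGroupHom G H) (x y : G) : f (x - y) = f x - f y :=
  f.toAddMonoidHom.map_sub x y
protected theorem map_sup (f : LatGroupHom G H) (x y : G) : f (x ⊔ y) = f x ⊔ f y := f.map_sup' x y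
protected theorem map_inf (f : LatGroupHom G H) (x y : G) : f (x ⊓ y) = f x ⊓ f y := f.map_inf' x y

protected theorem monotone (f : LatGroupHom G H) {x y : G} (h : x ≤ y) : f x ≤ f y := by
  have := f.map_sup x y
  rw [sup_eq_right.2 h] at this
  exact sup_eq_right.1 this.symm

/-- The identity homomorphism. -/
def id (G : Type*) [AddCommGroup G] [Lattice G] : LatGroupHom G G where
  __ := AddMonoidHom.id G
  map_sup' _ _ := rfl
  map_inf' _ _ := rfl

/-- Composition of homomorphisms. -/
def comp (g : LatGroupHom H K) (f : LatGroupHom G H) : LatGroupHom G K where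
  __ := g.toAddMonoidHom.comp f.toAddMonoidHom
  map_sup' x y := (congrArg g (f.map_sup x y)).trans (g.map_sup _ _)
  map_inf' x y := (congrArg g (f.map_inf x y)).trans (g.map_inf _ _)

end LatGroupHom

namespace AbLatGroup

instance : CoeSort AbLatGroup.{u} (Type u) := ⟨carrier⟩

attribute [instance] addCommGroup lattice isOrderedAddMonoid

instance : Category AbLatGroup.{u} where
  Hom G H := LatGroupHom G H
  id G := LatGroupHom.id G
  comp f g := g.comp f

end AbLatGroup

/-! ## The functor `Detrop`: removing the zero of an idempotent semifield -/

/-- The nonzero elements of `S`, written additively: `x + y` is the product of `S`, and the order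
is the natural one, `x ≤ y ↔ x + y = y` in `S`. -/
@[ext]
structure Detrop (S : Type u) [Semifield S] : Type u where
  val : S
  ne_zero : val ≠ 0

namespace Detrop

section Group

variable {S : Type u} [Semifield S]

instance : Zero (Detrop S) := ⟨⟨1, one_ne_zero⟩⟩
instance : Add (Detrop S) := ⟨fun x y => ⟨x.val * y.val, mul_ne_zero x.ne_zero y.ne_zero⟩⟩
instance : Neg (Detrop S) := ⟨fun x => ⟨x.val⁻¹, inv_ne_zero x.ne_zero⟩⟩

instance : AddCommGroup (Detrop S) where
  add_assoc _ _ _ := Detrop.ext (mul_assoc _ _ _)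
  zero_add _ := Detrop.ext (one_mul _)
  add_zero _ := Detrop.ext (mul_one _)
  neg_add_cancel x := Detrop.ext (inv_mul_cancel₀ x.ne_zero)
  add_comm _ _ := Detrop.ext (mul_comm _ _)
  nsmul := nsmulRec
  zsmul := zsmulRec

theorem add_val (x y : Detrop S) : (x + y).val = x.val * y.val := rfl
theorem zero_val : (0 : Detrop S).val = 1 := rfl
theorem neg_val (x : Detrop S) : (-x).val = x.val⁻¹ := rfl

end Group

variable (S : IdemSemifield.{u})

theorem add_ne_zero {a b : S} (ha : a ≠ 0) : a + b ≠ 0 := by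
  intro h
  apply ha
  calc a = a + (a + b) := by rw [h, add_zero]
    _ = 0 := by rw [← add_assoc, S.add_self, h]

theorem inv_add_eq {a b : S} (ha : a ≠ 0) (hb : b ≠ 0) (h : a + b = b) :
    b⁻¹ + a⁻¹ = a⁻¹ := by
  have h1 : a⁻¹ = a⁻¹ * b⁻¹ * (a + b) := by rw [h, mul_assoc, inv_mul_cancel₀ hb, mul_one]
  have h2 : a⁻¹ * b⁻¹ * (a + b) = b⁻¹ + a⁻¹ := by field_simp
  rw [← h2, ← h1]

instance : Lattice (Detrop S) where
  le x y := x.val + y.val = y.val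
  le_refl x := S.add_self x.val
  le_trans x y z (hxy : _ = _) (hyz : _ = _) := by
    rw [← hyz, ← add_assoc, hxy]
  le_antisymm x y (hxy : _ = _) (hyx : _ = _) := by
    apply Detrop.ext
    rw [← hxy, add_comm, hyx]
  sup x y := ⟨x.val + y.val, add_ne_zero S x.ne_zero⟩
  inf x y := ⟨(x.val⁻¹ + y.val⁻¹)⁻¹, inv_ne_zero (add_ne_zero S (inv_ne_zero x.ne_zero))⟩
  le_sup_left x y := by
    change x.val + (x.val + y.val) = x.val + y.val
    rw [← add_assoc, S.add_self]
  le_sup_right x y := by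
    change y.val + (x.val + y.val) = x.val + y.val
    rw [add_left_comm, S.add_self]
  sup_le x y z (hxz : _ = _) (hyz : _ = _) := by
    change x.val + y.val + z.val = z.val
    rw [add_assoc, hyz, hxz]
  inf_le_left x y := by
    have := inv_add_eq S (a := x.val⁻¹) (b := x.val⁻¹ + y.val⁻¹) (inv_ne_zero x.ne_zero)
      (add_ne_zero S (inv_ne_zero x.ne_zero)) (by rw [← add_assoc, S.add_self])
    rwa [inv_inv] at this
  inf_le_right x y := by
    have := inv_add_eq S (a := y.val⁻¹) (b := x.val⁻¹ + y.val⁻¹) (inv_ne_zero y.ne_zero)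
      (add_ne_zero S (inv_ne_zero x.ne_zero)) (by rw [add_left_comm, S.add_self])
    rwa [inv_inv] at this
  le_inf x y z hxy hxz := by
    have h1 := inv_add_eq S x.ne_zero y.ne_zero hxy
    have h2 := inv_add_eq S x.ne_zero z.ne_zero hxz
    have := inv_add_eq S (a := y.val⁻¹ + z.val⁻¹) (b := x.val⁻¹)
      (add_ne_zero S (inv_ne_zero y.ne_zero)) (inv_ne_zero x.ne_zero)
      (by rw [add_assoc, h2, h1])
    rwa [inv_inv] at this

theorem sup_val (x y : Detrop S) : (x ⊔ y).val = x.val + y.val := rfl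
theorem inf_val (x y : Detrop S) : (x ⊓ y).val = (x.val⁻¹ + y.val⁻¹)⁻¹ := rfl

instance : IsOrderedAddMonoid (Detrop S) where
  add_le_add_left x y (h : _ = _) z := by
    change x.val * z.val + y.val * z.val = y.val * z.val
    rw [← add_mul, h]

/-- A homomorphism of semifields restricts to the nonzero elements. -/
def map {S T : IdemSemifield.{u}} (f : S →+* T) : LatGroupHom (Detrop S) (Detrop T) where
  toFun x := ⟨f x.val, (map_ne_zero f).2 x.ne_zero⟩
  map_zero' := Detrop.ext (map_one f)
  map_add' x y := Detrop.ext (map_mul f _ _)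
  map_sup' x y := Detrop.ext (map_add f _ _)
  map_inf' x y := Detrop.ext (by simp [inf_val])

end Detrop

/-- The functor removing the zero of an additively idempotent semifield. -/
def detropFunctor : IdemSemifield.{u} ⥤ AbLatGroup.{u} where
  obj S := { carrier := Detrop S }
  map f := Detrop.map f

/-! ## MV-algebras

The sum `x ⊕ y` of an MV-algebra is written `x + y` and the negation `¬ x` is written `xᶜ`. -/

/-- MV-algebras. -/
class MVAlgebra (A : Type*) extends AddCommMonoid A, One A, Compl A where
  compl_zero' : (0 : A)ᶜ = 1
  add_one' : ∀ x : A, x + 1 = 1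
  compl_compl' : ∀ x : A, xᶜᶜ = x
  luk' : ∀ x y : A, (xᶜ + y)ᶜ + y = (yᶜ + x)ᶜ + x

namespace MVAlgebra

variable {A : Type*} [MVAlgebra A]

/-- The product of an MV-algebra. -/
def odot (x y : A) : A := (xᶜ + yᶜ)ᶜ

end MVAlgebra

infixl:70 " ⊙ " => MVAlgebra.odot

namespace MVAlgebra

variable {A : Type*} [MVAlgebra A]

theorem cc (x : A) : xᶜᶜ = x := compl_compl' x

theorem compl_inj' {x y : A} (h : xᶜ = yᶜ) : x = y := by rw [← cc x, h, cc]

theorem one_compl : (1 : A)ᶜ = 0 := by rw [← compl_zero', cc]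

theorem compl_add (x : A) : xᶜ + x = 1 := by
  have := luk' (1 : A) x
  rw [one_compl, zero_add, add_one'] at this
  exact this

instance : LE A := ⟨fun x y => ∃ z, y = x + z⟩

theorem le_def {x y : A} : x ≤ y ↔ ∃ z, y = x + z := Iff.rfl

theorem le_iff {x y : A} : x ≤ y ↔ xᶜ + y = 1 := by
  constructor
  · rintro ⟨z, rfl⟩
    rw [← add_assoc, compl_add, add_comm, add_one']
  · intro h
    refine ⟨(yᶜ + x)ᶜ, ?_⟩
    have := luk' x y
    rw [h, one_compl, zero_add] at this
    rw [add_comm]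
    exact this

theorem le_add (x y : A) : x ≤ x + y := ⟨y, rfl⟩

theorem le_trans_mv {x y z : A} (h : x ≤ y) (h' : y ≤ z) : x ≤ z := by
  obtain ⟨a, rfl⟩ := h
  obtain ⟨b, rfl⟩ := h'
  exact ⟨a + b, add_assoc _ _ _⟩

theorem add_mono {x y : A} (h : x ≤ y) (z : A) : x + z ≤ y + z := by
  obtain ⟨a, rfl⟩ := h
  exact ⟨a, add_right_comm _ _ _⟩

theorem compl_anti {x y : A} (h : x ≤ y) : yᶜ ≤ xᶜ := by
  rw [le_iff] at h ⊢
  rwa [cc, add_comm]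

/-- The lattice order of an MV-algebra: `x ≤ y` if and only if `y = x ⊕ z` for some `z`. -/
instance : Lattice A where
  le_refl x := ⟨0, (add_zero x).symm⟩
  le_trans _ _ _ := le_trans_mv
  le_antisymm x y h h' := by
    rw [le_iff] at h h'
    have := luk' x y
    rw [h, h', one_compl, zero_add, zero_add] at this
    exact this.symm
  sup x y := (xᶜ + y)ᶜ + y
  inf x y := ((xᶜᶜ + yᶜ)ᶜ + yᶜ)ᶜ
  le_sup_left x y := ⟨(yᶜ + x)ᶜ, by rw [luk', add_comm]⟩
  le_sup_right x y := ⟨(xᶜ + y)ᶜ, add_comm _ _⟩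
  sup_le x y z hx hy := by
    have hz : (zᶜ + y)ᶜ + y = z := by
      rw [luk', le_iff.1 hy, one_compl, zero_add]
    have := add_mono (compl_anti (add_mono (compl_anti hx) y)) y
    rwa [hz] at this
  inf_le_left x y := by
    have : xᶜ ≤ (xᶜᶜ + yᶜ)ᶜ + yᶜ := ⟨(yᶜᶜ + xᶜ)ᶜ, by rw [luk', add_comm]⟩
    simpa only [cc] using compl_anti this
  inf_le_right x y := by
    have : yᶜ ≤ (xᶜᶜ + yᶜ)ᶜ + yᶜ := ⟨(xᶜᶜ + yᶜ)ᶜ, add_comm _ _⟩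
    simpa only [cc] using compl_anti this
  le_inf z x y hx hy := by
    have hz : (zᶜᶜ + yᶜ)ᶜ + yᶜ = zᶜ := by
      rw [luk', le_iff.1 (compl_anti hy), one_compl, zero_add]
    have := add_mono (compl_anti (add_mono (compl_anti (compl_anti hx)) yᶜ)) yᶜ
    rw [hz] at this
    simpa only [cc] using compl_anti this

theorem sup_def (x y : A) : x ⊔ y = (xᶜ + y)ᶜ + y := rfl
theorem inf_def (x y : A) : x ⊓ y = ((xᶜᶜ + yᶜ)ᶜ + yᶜ)ᶜ := rfl

instance : IsOrderedAddMonoid A where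
  add_le_add_left _ _ h z := add_mono h z

instance : OrderTop A where
  top := 1
  le_top x := ⟨1, (add_one' x).symm⟩

theorem top_def : (⊤ : A) = 1 := rfl

theorem zero_le_mv (x : A) : 0 ≤ x := ⟨x, (zero_add x).symm⟩
theorem le_one_mv (x : A) : x ≤ 1 := le_top (a := x)

theorem compl_odot (x y : A) : (x ⊙ y)ᶜ = xᶜ + yᶜ := cc _

theorem odot_comm (x y : A) : x ⊙ y = y ⊙ x := by simp only [odot, add_comm]

theorem odot_le_iff {x y z : A} : x ⊙ y ≤ z ↔ x ≤ yᶜ + z := by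
  rw [le_iff, le_iff, compl_odot, add_assoc]

theorem odot_le_iff' {x y z : A} : x ⊙ y ≤ z ↔ y ≤ xᶜ + z := by rw [odot_comm, odot_le_iff]

theorem odot_mono {x x' y y' : A} (h : x ≤ x') (h' : y ≤ y') : x ⊙ y ≤ x' ⊙ y' :=
  compl_anti (add_le_add (compl_anti h) (compl_anti h'))

theorem odot_zero_iff {x y : A} : x ⊙ y = 0 ↔ x ≤ yᶜ := by
  rw [← add_zero yᶜ, ← odot_le_iff]
  exact ⟨fun h => h.le, fun h => le_antisymm h (zero_le_mv _)⟩

theorem odot_one (x : A) : x ⊙ 1 = x := by rw [odot, one_compl, add_zero, cc]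
theorem one_odot (x : A) : 1 ⊙ x = x := by rw [odot_comm, odot_one]

/-- Subtracting a summand of a sum without truncation. -/
theorem add_odot_compl {x y : A} (h : y ≤ xᶜ) : (x + y) ⊙ xᶜ = y := by
  apply compl_inj'
  rw [compl_odot, cc]
  have h3 : (x + y)ᶜ + x = yᶜ ⊔ x := by rw [sup_def, cc, add_comm x y]
  rw [h3]
  exact sup_eq_left.2 (by simpa only [cc] using compl_anti h)

theorem sub_add_of_le {x m : A} (h : m ≤ x) : x ⊙ mᶜ + m = x := by
  have : x ⊔ m = x := sup_eq_left.2 h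
  rwa [sup_def, ← cc m, ← odot, cc] at this

theorem prelinear (x y : A) : (xᶜ + y) ⊔ (yᶜ + x) = 1 := by
  have key : ∀ z : A, z ≤ x ⊙ yᶜ → z ≤ y ⊙ xᶜ → z = 0 := by
    intro z h1 h2
    have h1' : z ≤ x ⊙ (x ⊓ y)ᶜ := h1.trans (odot_mono le_rfl (compl_anti inf_le_right))
    have h2' : z ≤ y ⊙ (x ⊓ y)ᶜ := h2.trans (odot_mono le_rfl (compl_anti inf_le_left))
    have hx : z + x ⊓ y ≤ x := (add_mono h1' _).trans (sub_add_of_le inf_le_left).le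
    have hy : z + x ⊓ y ≤ y := (add_mono h2' _).trans (sub_add_of_le inf_le_right).le
    have hm : x ⊓ y + z = x ⊓ y :=
      le_antisymm (by rw [add_comm]; exact le_inf hx hy) (le_add _ _)
    have hz : z ≤ (x ⊓ y)ᶜ := h1'.trans
      ((odot_mono (le_one_mv x) le_rfl).trans (one_odot _).le)
    rw [← add_odot_compl hz, hm, odot_zero_iff, cc]
  have e1 : (x ⊙ yᶜ)ᶜ = xᶜ + y := by rw [compl_odot, cc]
  have e2 : (y ⊙ xᶜ)ᶜ = yᶜ + x := by rw [compl_odot, cc]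
  rw [← cc ((xᶜ + y) ⊔ (yᶜ + x)), ← compl_zero']
  congr 1
  apply key
  · rw [← cc (x ⊙ yᶜ), e1]; exact compl_anti le_sup_left
  · rw [← cc (y ⊙ xᶜ), e2]; exact compl_anti le_sup_right

theorem odot_le_sq_sup_sq (x y : A) : x ⊙ y ≤ x ⊙ x ⊔ y ⊙ y := by
  have aux : ∀ a b : A, aᶜ + b ≤ (a ⊙ b)ᶜ + b ⊙ b := by
    intro a b
    have h1 : a ⊓ b ≤ b := inf_le_right
    have h2 : a ⊙ (aᶜ + b) ≤ b := odot_le_iff'.2 le_rfl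
    have h3 : (aᶜ + b) ⊙ (a ⊙ b) = (a ⊙ (aᶜ + b)) ⊙ b := by
      apply compl_inj'
      simp only [compl_odot]
      abel
    rw [← odot_le_iff, h3]
    exact odot_mono h2 le_rfl
  have h : (1 : A) ≤ (x ⊙ y)ᶜ + (x ⊙ x ⊔ y ⊙ y) := by
    rw [← prelinear x y]
    apply sup_le
    · exact (aux x y).trans (by gcongr; exact le_sup_right)
    · rw [odot_comm x y]
      exact (aux y x).trans (by gcongr; exact le_sup_left)
  rw [le_iff]
  exact le_antisymm (le_one_mv _) h

/-- Infinitesimal elements: `n x ≤ ¬ x` for all positive integers `n`. -/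
def IsInfinitesimal (x : A) : Prop := ∀ n : ℕ, 0 < n → n • x ≤ xᶜ

/-- Perfect MV-algebras: `A` is the disjoint union of its radical, which is the set of all
infinitesimals, and its co-radical, which is the set of the negations of infinitesimals. -/
class IsPerfect (A : Type*) [MVAlgebra A] : Prop where
  xor : ∀ x : A, Xor (IsInfinitesimal x) (IsInfinitesimal xᶜ)

theorem IsInfinitesimal.mono {x y : A} (hy : IsInfinitesimal y) (h : x ≤ y) :
    IsInfinitesimal x := fun n hn =>
  (nsmul_le_nsmul_right h n).trans ((hy n hn).trans (compl_anti h))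

theorem isInfinitesimal_zero : IsInfinitesimal (0 : A) := fun n _ => by
  rw [smul_zero]; exact zero_le_mv _

theorem IsInfinitesimal.sq {x : A} (hx : IsInfinitesimal x) : x ⊙ x = 0 :=
  odot_zero_iff.2 (by simpa using hx 1 one_pos)

theorem IsInfinitesimal.odot {x y : A} (hx : IsInfinitesimal x) (hy : IsInfinitesimal y) :
    x ⊙ y = 0 := by
  have := odot_le_sq_sup_sq x y
  rw [hx.sq, hy.sq, sup_idem] at this
  exact le_antisymm this (zero_le_mv _)

/-- Associativity of the untruncated sum. -/
theorem le_compl_add {a b c : A} (h : a ≤ bᶜ) (h' : a + b ≤ cᶜ) : a ≤ (b + c)ᶜ := by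
  rw [← add_odot_compl (x := b) (y := a) h, add_comm b a]
  have : (b + c)ᶜ = cᶜ ⊙ bᶜ := by
    apply compl_inj'
    rw [cc, compl_odot, cc, cc, add_comm]
  rw [this]
  exact odot_mono h' le_rfl

theorem IsInfinitesimal.nsmul_le {x : A} (hx : IsInfinitesimal x) (k n : ℕ) :
    k • x ≤ (n • x)ᶜ := by
  have h0 : ∀ m : ℕ, m • x ≤ xᶜ := fun m => by
    rcases Nat.eq_zero_or_pos m with rfl | hm
    · rw [zero_smul]; exact zero_le_mv _
    · exact hx m hm
  induction n with
  | zero => rw [zero_smul, compl_zero']; exact le_one_mv _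
  | succ n ih =>
    rw [succ_nsmul]
    refine le_compl_add ih ?_
    rw [← add_nsmul]
    exact h0 _

theorem IsInfinitesimal.nsmul {x : A} (hx : IsInfinitesimal x) (n : ℕ) :
    IsInfinitesimal (n • x) := fun m _ => by
  rw [← mul_nsmul]
  exact hx.nsmul_le _ _

/-- The elements `x` with `2 x² ≤ x`. -/
def InTheta (x : A) : Prop := x ⊙ x + x ⊙ x ≤ x

theorem IsInfinitesimal.inTheta {x : A} (hx : IsInfinitesimal x) : InTheta x := by
  rw [InTheta, hx.sq, add_zero]; exact zero_le_mv _

theorem inTheta_one : InTheta (1 : A) := le_one_mv _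

section Perfect

variable [IsPerfect A]

theorem zero_ne_one_mv : (0 : A) ≠ 1 := by
  intro h
  have h1 : IsInfinitesimal (0 : A)ᶜ := by
    rw [compl_zero', ← h]; exact isInfinitesimal_zero
  have := IsPerfect.xor (0 : A)
  simp [Xor, isInfinitesimal_zero, h1] at this

theorem isInfinitesimal_or (x : A) : IsInfinitesimal x ∨ IsInfinitesimal xᶜ :=
  Xor.or (IsPerfect.xor x)

theorem not_isInfinitesimal_one : ¬ IsInfinitesimal (1 : A) := by
  intro h
  have := h.sq
  rw [odot_one] at this
  exact zero_ne_one_mv this.symm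

theorem IsInfinitesimal.sup {x y : A} (hx : IsInfinitesimal x) (hy : IsInfinitesimal y) :
    IsInfinitesimal (x ⊔ y) := by
  rcases isInfinitesimal_or (x ⊔ y) with h | h
  · exact h
  · refine h.mono (sup_le ?_ ?_)
    · have h1 : x ⊔ y ≤ xᶜ :=
        sup_le (odot_zero_iff.1 hx.sq) (odot_zero_iff.1 (hy.odot hx))
      simpa only [cc] using compl_anti h1
    · have h1 : x ⊔ y ≤ yᶜ :=
        sup_le (odot_zero_iff.1 (hx.odot hy)) (odot_zero_iff.1 hy.sq)
      simpa only [cc] using compl_anti h1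

theorem IsInfinitesimal.add {x y : A} (hx : IsInfinitesimal x) (hy : IsInfinitesimal y) :
    IsInfinitesimal (x + y) := by
  refine ((hx.sup hy).nsmul 2).mono ?_
  rw [two_nsmul]
  exact add_le_add le_sup_left le_sup_right

theorem inTheta_iff {x : A} : InTheta x ↔ IsInfinitesimal x ∨ x = 1 := by
  constructor
  · intro h
    rcases isInfinitesimal_or x with h' | h'
    · exact Or.inl h'
    · right
      have h2 := (h'.nsmul 2).sq
      have h3 : x ⊙ x + x ⊙ x = 1 := by
        rw [← compl_zero', ← h2, two_nsmul, compl_odot]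
        rfl
      rw [InTheta, h3] at h
      exact le_antisymm (le_one_mv x) h
  · rintro (h | rfl)
    · exact h.inTheta
    · exact inTheta_one

theorem inTheta_add {x y : A} (hx : InTheta x) (hy : InTheta y) : InTheta (x + y) := by
  rcases inTheta_iff.1 hx with h | rfl
  · rcases inTheta_iff.1 hy with h' | rfl
    · exact (h.add h').inTheta
    · rw [add_one']; exact inTheta_one
  · rw [add_comm, add_one']; exact inTheta_one

theorem inTheta_sup {x y : A} (hx : InTheta x) (hy : InTheta y) : InTheta (x ⊔ y) := by
  rcases inTheta_iff.1 hx with h | rfl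
  · rcases inTheta_iff.1 hy with h' | rfl
    · exact (h.sup h').inTheta
    · rw [sup_eq_right.2 (le_one_mv x)]; exact inTheta_one
  · rw [sup_eq_left.2 (le_one_mv y)]; exact inTheta_one

theorem inTheta_inf {x y : A} (hx : InTheta x) (hy : InTheta y) : InTheta (x ⊓ y) := by
  rcases inTheta_iff.1 hx with h | rfl
  · exact (h.mono inf_le_left).inTheta
  · rwa [inf_eq_right.2 (le_one_mv y)]

end Perfect

end MVAlgebra

/-- Homomorphisms of MV-algebras. -/
@[ext]
structure MVHom (A B : Type*) [MVAlgebra A] [MVAlgebra B] extends A →+ B where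
  map_compl' : ∀ x : A, toFun xᶜ = (toFun x)ᶜ

namespace MVHom

open MVAlgebra

variable {A B C : Type*} [MVAlgebra A] [MVAlgebra B] [MVAlgebra C]

instance : FunLike (MVHom A B) A B where
  coe f := f.toFun
  coe_injective _ _ h := MVHom.ext h

/-- The identity homomorphism. -/
def id (A : Type*) [MVAlgebra A] : MVHom A A where
  __ := AddMonoidHom.id A
  map_compl' _ := rfl

/-- Composition of homomorphisms. -/
def comp (g : MVHom B C) (f : MVHom A B) : MVHom A C where
  __ := g.toAddMonoidHom.comp f.toAddMonoidHom
  map_compl' x := (congrArg g (f.map_compl' x)).trans (g.map_compl' _)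

protected theorem map_zero (f : MVHom A B) : f 0 = 0 := f.map_zero'
protected theorem map_add (f : MVHom A B) (x y : A) : f (x + y) = f x + f y := f.map_add' x y
protected theorem map_compl (f : MVHom A B) (x : A) : f xᶜ = (f x)ᶜ := f.map_compl' x
protected theorem map_one (f : MVHom A B) : f 1 = 1 := by
  rw [← compl_zero', f.map_compl, f.map_zero, compl_zero']
protected theorem map_odot (f : MVHom A B) (x y : A) : f (x ⊙ y) = f x ⊙ f y := by
  simp only [odot, f.map_compl, f.map_add]
protected theorem map_sup (f : MVHom A B) (x y : A) : f (x ⊔ y) = f x ⊔ f y := by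
  simp only [sup_def, f.map_compl, f.map_add]
protected theorem map_inf (f : MVHom A B) (x y : A) : f (x ⊓ y) = f x ⊓ f y := by
  simp only [inf_def, f.map_compl, f.map_add]

protected theorem monotone (f : MVHom A B) {x y : A} (h : x ≤ y) : f x ≤ f y := by
  obtain ⟨z, rfl⟩ := h
  exact ⟨f z, f.map_add x z⟩

protected theorem map_nsmul (f : MVHom A B) (n : ℕ) (x : A) : f (n • x) = n • f x :=
  f.toAddMonoidHom.map_nsmul n x

theorem map_isInfinitesimal (f : MVHom A B) {x : A} (h : IsInfinitesimal x) :
    IsInfinitesimal (f x) := fun n hn => by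
  rw [← f.map_nsmul, ← f.map_compl]
  exact f.monotone (h n hn)

theorem map_inTheta (f : MVHom A B) {x : A} (h : InTheta x) : InTheta (f x) := by
  rw [InTheta, ← f.map_odot, ← f.map_add]
  exact f.monotone h

end MVHom

/-- The category of perfect MV-algebras. -/
structure PerfMV : Type (u + 1) where
  carrier : Type u
  [mvAlgebra : MVAlgebra carrier]
  [isPerfect : MVAlgebra.IsPerfect carrier]

namespace PerfMV

instance : CoeSort PerfMV.{u} (Type u) := ⟨carrier⟩

attribute [instance] mvAlgebra isPerfect

instance : Category PerfMV.{u} where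
  Hom A B := MVHom A B
  id A := MVHom.id A
  comp f g := g.comp f

end PerfMV

/-! ## Mundici's functor `Γ` and the functor `Δ` -/

/-- The interval `[0, w]` of a lattice-ordered group. -/
@[ext]
structure Gamma (G : Type u) [AddCommGroup G] [Lattice G] (w : G) : Type u where
  val : G
  nonneg : 0 ≤ val
  le : val ≤ w

namespace Gamma

variable {G : Type u} [AddCommGroup G] [Lattice G] [IsOrderedAddMonoid G] {w : G}

instance [hw : Fact (0 ≤ w)] : Zero (Gamma G w) := ⟨⟨0, le_rfl, hw.out⟩⟩
instance [hw : Fact (0 ≤ w)] : Add (Gamma G w) :=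
  ⟨fun x y => ⟨(x.val + y.val) ⊓ w, le_inf (add_nonneg x.nonneg y.nonneg) hw.out, inf_le_right⟩⟩

/-- `Γ(G, w)`: the interval `[0, w]` with `x ⊕ y = (x + y) ∧ w` and `¬ x = w - x`. -/
instance [hw : Fact (0 ≤ w)] : MVAlgebra (Gamma G w) where
  one := ⟨w, hw.out, le_rfl⟩
  compl x := ⟨w - x.val, sub_nonneg.2 x.le, sub_le_self _ x.nonneg⟩
  nsmul := nsmulRec
  add_assoc x y z := Gamma.ext (by
    change ((x.val + y.val) ⊓ w + z.val) ⊓ w = (x.val + (y.val + z.val) ⊓ w) ⊓ w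
    rw [inf_add, add_inf, inf_assoc, inf_assoc, inf_eq_right.2 (le_add_of_nonneg_right z.nonneg),
      inf_eq_right.2 (le_add_of_nonneg_left x.nonneg), add_assoc])
  zero_add x := Gamma.ext (by
    change (0 + x.val) ⊓ w = x.val
    rw [zero_add, inf_eq_left.2 x.le])
  add_zero x := Gamma.ext (by
    change (x.val + 0) ⊓ w = x.val
    rw [add_zero, inf_eq_left.2 x.le])
  add_comm x y := Gamma.ext (by
    change (x.val + y.val) ⊓ w = (y.val + x.val) ⊓ w
    rw [add_comm])
  compl_zero' := Gamma.ext (sub_zero w)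
  add_one' x := Gamma.ext (inf_eq_right.2 (le_add_of_nonneg_left x.nonneg))
  compl_compl' x := Gamma.ext (sub_sub_cancel w x.val)
  luk' x y := Gamma.ext (by
    have key : ∀ a b : G, w - (w - a + b) ⊓ w + b = a ⊔ b := fun a b => by
      rw [sub_inf, sub_self, sup_add, zero_add]
      congr 1
      abel
    change (w - (w - x.val + y.val) ⊓ w + y.val) ⊓ w = (w - (w - y.val + x.val) ⊓ w + x.val) ⊓ w
    rw [key, key, sup_comm])

section

variable [Fact (0 ≤ w)]

theorem add_val (x y : Gamma G w) : (x + y).val = (x.val + y.val) ⊓ w := rfl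
theorem zero_val : (0 : Gamma G w).val = 0 := rfl
theorem one_val : (1 : Gamma G w).val = w := rfl
theorem compl_val (x : Gamma G w) : xᶜ.val = w - x.val := rfl

theorem le_iff_val {x y : Gamma G w} : x ≤ y ↔ x.val ≤ y.val := by
  rw [MVAlgebra.le_iff, Gamma.ext_iff, add_val, compl_val, one_val, inf_eq_right,
    ← sub_nonneg, ← sub_nonneg (a := y.val)]
  rw [show w - x.val + y.val - w = y.val - x.val by abel]

end

/-- A homomorphism of lattice-ordered groups carrying `w` to `w'` restricts to the intervals. -/
def map {H : Type u} [AddCommGroup H] [Lattice H] [IsOrderedAddMonoid H] {w' : H}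
    [Fact (0 ≤ w)] [Fact (0 ≤ w')] (f : LatGroupHom G H) (hf : f w = w') :
    MVHom (Gamma G w) (Gamma H w') where
  toFun x := ⟨f x.val, f.map_zero ▸ f.monotone x.nonneg, hf ▸ f.monotone x.le⟩
  map_zero' := Gamma.ext f.map_zero
  map_add' x y := Gamma.ext (by simp only [add_val, f.map_inf, f.map_add, hf])
  map_compl' x := Gamma.ext (by simp only [compl_val, f.map_sub, hf])

end Gamma

/-! The lexicographic product of the integers with a lattice-ordered group -/

namespace LexInt

variable {G : Type u}

section Lattice

variable [Lattice G]

theorem le_iff {x y : ℤ ×ₗ G} :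
    x ≤ y ↔ (ofLex x).1 < (ofLex y).1 ∨ (ofLex x).1 = (ofLex y).1 ∧ (ofLex x).2 ≤ (ofLex y).2 :=
  Prod.Lex.le_iff

/-- Binary suprema and infima for the lexicographic order. -/
noncomputable instance : Lattice (ℤ ×ₗ G) where
  sup x y := toLex
    (if (ofLex x).1 < (ofLex y).1 then ofLex y
      else if (ofLex y).1 < (ofLex x).1 then ofLex x
      else ((ofLex x).1, (ofLex x).2 ⊔ (ofLex y).2))
  inf x y := toLex
    (if (ofLex x).1 < (ofLex y).1 then ofLex x
      else if (ofLex y).1 < (ofLex x).1 then ofLex y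
      else ((ofLex x).1, (ofLex x).2 ⊓ (ofLex y).2))
  le_sup_left x y := by
    rw [le_iff, ofLex_toLex]
    split_ifs with h1 h2
    · exact Or.inl h1
    · exact Or.inr ⟨rfl, le_rfl⟩
    · exact Or.inr ⟨rfl, le_sup_left⟩
  le_sup_right x y := by
    rw [le_iff, ofLex_toLex]
    split_ifs with h1 h2
    · exact Or.inr ⟨rfl, le_rfl⟩
    · exact Or.inl h2
    · exact Or.inr ⟨by simp only; omega, le_sup_right⟩
  sup_le x y z hx hy := by
    rw [le_iff] at hx hy ⊢
    rw [ofLex_toLex]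
    split_ifs with h1 h2
    · exact hy
    · exact hx
    · rcases hx with hx | hx
      · exact Or.inl hx
      · rcases hy with hy | hy
        · exact Or.inl (by simp only; omega)
        · exact Or.inr ⟨hx.1, sup_le hx.2 hy.2⟩
  inf_le_left x y := by
    rw [le_iff, ofLex_toLex]
    split_ifs with h1 h2
    · exact Or.inr ⟨rfl, le_rfl⟩
    · exact Or.inl h2
    · exact Or.inr ⟨rfl, inf_le_left⟩
  inf_le_right x y := by
    rw [le_iff, ofLex_toLex]
    split_ifs with h1 h2
    · exact Or.inl h1
    · exact Or.inr ⟨rfl, le_rfl⟩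
    · exact Or.inr ⟨by simp only; omega, inf_le_right⟩
  le_inf z x y hx hy := by
    rw [le_iff] at hx hy ⊢
    rw [ofLex_toLex]
    split_ifs with h1 h2
    · exact hx
    · exact hy
    · rcases hx with hx | hx
      · exact Or.inl hx
      · rcases hy with hy | hy
        · exact Or.inl (by simp only; omega)
        · exact Or.inr ⟨hx.1, le_inf hx.2 hy.2⟩

theorem sup_def (x y : ℤ ×ₗ G) : x ⊔ y = toLex
    (if (ofLex x).1 < (ofLex y).1 then ofLex y
      else if (ofLex y).1 < (ofLex x).1 then ofLex x
      else ((ofLex x).1, (ofLex x).2 ⊔ (ofLex y).2)) := rfl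
theorem inf_def (x y : ℤ ×ₗ G) : x ⊓ y = toLex
    (if (ofLex x).1 < (ofLex y).1 then ofLex x
      else if (ofLex y).1 < (ofLex x).1 then ofLex y
      else ((ofLex x).1, (ofLex x).2 ⊓ (ofLex y).2)) := rfl

end Lattice

variable [AddCommGroup G] [Lattice G]

instance [IsOrderedAddMonoid G] : IsOrderedAddMonoid (ℤ ×ₗ G) where
  add_le_add_left x y h z := by
    rw [le_iff] at h ⊢
    rcases h with h | h
    · exact Or.inl (add_lt_add_left h _)
    · exact Or.inr ⟨congrArg (· + (ofLex z).1) h.1, add_le_add_left h.2 _⟩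

/-- The element `(1, 0)`. -/
def unit (G : Type u) [AddCommGroup G] : ℤ ×ₗ G := toLex (1, 0)

instance : Fact (0 ≤ unit G) := ⟨le_iff.2 (Or.inl one_pos)⟩

/-- The map `(n, g) ↦ (n, f g)`. -/
def map {H : Type u} [AddCommGroup H] [Lattice H] (f : LatGroupHom G H) :
    LatGroupHom (ℤ ×ₗ G) (ℤ ×ₗ H) where
  toFun x := toLex ((ofLex x).1, f (ofLex x).2)
  map_zero' := congrArg toLex (Prod.ext rfl f.map_zero)
  map_add' x y := congrArg toLex (Prod.ext rfl (f.map_add _ _))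
  map_sup' x y := by
    simp only [sup_def, ofLex_toLex]
    split_ifs <;> simp [f.map_sup, *]
  map_inf' x y := by
    simp only [inf_def, ofLex_toLex]
    split_ifs <;> simp [f.map_inf, *]

theorem map_unit {H : Type u} [AddCommGroup H] [Lattice H] (f : LatGroupHom G H) :
    map f (unit G) = unit H := congrArg toLex (Prod.ext rfl f.map_zero)

end LexInt

/-- `Δ(G) = Γ(ℤ ×ₗ G, (1, 0))`. -/
abbrev Delta (G : Type u) [AddCommGroup G] [Lattice G] [IsOrderedAddMonoid G] : Type u :=
  Gamma (ℤ ×ₗ G) (LexInt.unit G)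

namespace Delta

open MVAlgebra

variable {G : Type u} [AddCommGroup G] [Lattice G] [IsOrderedAddMonoid G]

theorem fst_eq (x : Delta G) : (ofLex x.val).1 = 0 ∨ (ofLex x.val).1 = 1 := by
  have h1 : 0 ≤ (ofLex x.val).1 := by
    rcases LexInt.le_iff.1 x.nonneg with h | h
    · exact h.le
    · exact h.1.le
  have h2 : (ofLex x.val).1 ≤ 1 := by
    rcases LexInt.le_iff.1 x.le with h | h
    · exact h.le
    · exact h.1.le
  omega

theorem fst_nsmul {x : Delta G} (h : (ofLex x.val).1 = 0) (n : ℕ) :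
    (ofLex (n • x).val).1 = 0 := by
  induction n with
  | zero => rw [zero_smul]; rfl
  | succ n ih =>
    have hs : (ofLex ((n • x).val + x.val)).1 = 0 := by
      change (ofLex (n • x).val).1 + (ofLex x.val).1 = 0
      rw [ih, h, add_zero]
    rw [succ_nsmul, Gamma.add_val, LexInt.inf_def, if_pos]
    · exact hs
    · rw [hs]; exact one_pos

theorem isInfinitesimal_iff (x : Delta G) : IsInfinitesimal x ↔ (ofLex x.val).1 = 0 := by
  constructor
  · intro h
    rcases fst_eq x with h0 | h1
    · exact h0
    · have h2 := Gamma.le_iff_val.1 (h 1 one_pos)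
      rw [one_smul, Gamma.compl_val, LexInt.le_iff] at h2
      have h3 : (ofLex (LexInt.unit G - x.val)).1 = 1 - (ofLex x.val).1 := rfl
      rw [h3] at h2
      rcases h2 with h2 | h2 <;> omega
  · intro h n _
    rw [Gamma.le_iff_val, Gamma.compl_val, LexInt.le_iff]
    left
    have h3 : (ofLex (LexInt.unit G - x.val)).1 = 1 - (ofLex x.val).1 := rfl
    rw [h3, fst_nsmul h, h]
    norm_num

instance : IsPerfect (Delta G) where
  xor x := by
    rw [isInfinitesimal_iff, isInfinitesimal_iff]
    have h3 : (ofLex xᶜ.val).1 = 1 - (ofLex x.val).1 := rfl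
    rw [h3]
    rcases fst_eq x with h | h <;> simp [h, Xor]

end Delta

/-- The functor `Δ` from abelian lattice-ordered groups to perfect MV-algebras. -/
noncomputable def deltaFunctor : AbLatGroup.{u} ⥤ PerfMV.{u} where
  obj G := { carrier := Delta G }
  map f := Gamma.map (LexInt.map f) (LexInt.map_unit f)

/-! ## The category `TOP` -/

/-- The category `TOP`. An object is (up to an isomorphism of its order and addition) the positive
cone `{g | 0 ≤ g}` of an abelian lattice-ordered group with a top element adjoined, for which
`⊤ + x = ⊤`. The elements other than `⊤` form the positive cone of the object. -/
structure ConeTop : Type (u + 1) where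
  carrier : Type u
  [addCommMonoid : AddCommMonoid carrier]
  [lattice : Lattice carrier]
  [orderTop : OrderTop carrier]
  isCone : ∃ G : AbLatGroup.{u}, Nonempty (carrier ≃+o WithTop {g : G // 0 ≤ g})

/-- Morphisms of `TOP`: they preserve the operations `+`, `0`, `⊔`, `⊓`, the positive cone, and the
top element. -/
@[ext]
structure ConeTopHom (S T : Type*) [AddCommMonoid S] [Lattice S] [OrderTop S]
    [AddCommMonoid T] [Lattice T] [OrderTop T] extends S →+ T where
  map_sup' : ∀ x y : S, toFun (x ⊔ y) = toFun x ⊔ toFun y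
  map_inf' : ∀ x y : S, toFun (x ⊓ y) = toFun x ⊓ toFun y
  map_cone' : ∀ x : S, x ≠ ⊤ → toFun x ≠ ⊤
  map_top' : toFun ⊤ = ⊤

namespace ConeTopHom

variable {R S T : Type*} [AddCommMonoid R] [Lattice R] [OrderTop R]
  [AddCommMonoid S] [Lattice S] [OrderTop S] [AddCommMonoid T] [Lattice T] [OrderTop T]

instance : FunLike (ConeTopHom S T) S T where
  coe f := f.toFun
  coe_injective _ _ h := ConeTopHom.ext h

/-- The identity morphism. -/
def id (S : Type*) [AddCommMonoid S] [Lattice S] [OrderTop S] : ConeTopHom S S where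
  __ := AddMonoidHom.id S
  map_sup' _ _ := rfl
  map_inf' _ _ := rfl
  map_cone' _ h := h
  map_top' := rfl

/-- Composition of morphisms. -/
def comp (g : ConeTopHom S T) (f : ConeTopHom R S) : ConeTopHom R T where
  __ := g.toAddMonoidHom.comp f.toAddMonoidHom
  map_sup' x y := (congrArg g (f.map_sup' x y)).trans (g.map_sup' _ _)
  map_inf' x y := (congrArg g (f.map_inf' x y)).trans (g.map_inf' _ _)
  map_cone' x h := g.map_cone' _ (f.map_cone' x h)
  map_top' := (congrArg g f.map_top').trans g.map_top'

end ConeTopHom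

namespace ConeTop

instance : CoeSort ConeTop.{u} (Type u) := ⟨carrier⟩

attribute [instance] addCommMonoid lattice orderTop

instance : Category ConeTop.{u} where
  Hom S T := ConeTopHom S T
  id S := ConeTopHom.id S
  comp f g := g.comp f

end ConeTop

/-! A lattice-ordered cancellative monoid with the order of divisibility is the positive cone of an
abelian lattice-ordered group. This is needed to see that `θ` takes its values in `TOP`. -/

namespace Cone

/-- The group of differences. -/
abbrev Diff (M : Type u) [AddCommMonoid M] : Type u := Algebra.GrothendieckAddGroup M

/-- The difference `a - b`. -/
def mk {M : Type u} [AddCommMonoid M] (a b : M) : Diff M := AddLocalization.mk a ⟨b, trivial⟩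

section

variable {M : Type u} [AddCommMonoid M]

theorem mk_add_mk (a b c d : M) : mk a b + mk c d = mk (a + c) (b + d) :=
  AddLocalization.mk_add _ _ _ _

theorem zero_eq : (0 : Diff M) = mk 0 0 := AddLocalization.mk_zero.symm

theorem neg_mk (a b : M) : -mk a b = mk b a := Algebra.GrothendieckAddGroup.neg_mk _ _

theorem exists_mk (x : Diff M) : ∃ a b : M, x = mk a b := by
  induction x using AddLocalization.ind with
  | _ p => exact ⟨p.1, p.2.1, rfl⟩

end

section

variable {M : Type u} [AddCommMonoid M] [Lattice M] [IsOrderedCancelAddMonoid M]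

theorem sup_add_le (hM : ∀ a b : M, a ≤ b → ∃ c, b = a + c) (hM' : ∀ a b : M, a ≤ a + b)
    {a b c d : M} (h : c + a ≤ d) (h' : c + b ≤ d) : c + (a ⊔ b) ≤ d := by
  obtain ⟨e, rfl⟩ := hM c d ((hM' c a).trans h)
  exact add_le_add_right (sup_le (le_of_add_le_add_left h) (le_of_add_le_add_left h')) c

theorem mk_le_mk {a b c d : M} : mk a b ≤ mk c d ↔ d + a ≤ b + c := Iff.rfl

theorem mk_eq_mk {a b c d : M} : mk a b = mk c d ↔ d + a = b + c := by
  constructor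
  · intro h
    exact le_antisymm (mk_le_mk.1 h.le) (mk_le_mk.1 h.ge)
  · intro h
    exact le_antisymm (mk_le_mk.2 h.le) (mk_le_mk.2 h.ge)

instance : IsOrderedAddMonoid (Diff M) where
  add_le_add_left x y h z := by
    obtain ⟨a, b, rfl⟩ := exists_mk x
    obtain ⟨c, d, rfl⟩ := exists_mk y
    obtain ⟨e, f, rfl⟩ := exists_mk z
    rw [mk_add_mk, mk_add_mk, mk_le_mk]
    rw [mk_le_mk] at h
    calc d + f + (a + e) = (d + a) + (f + e) := by abel
      _ ≤ (b + c) + (f + e) := add_le_add_left h _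
      _ = b + f + (c + e) := by abel

theorem exists_isLUB (hM : ∀ a b : M, a ≤ b → ∃ c, b = a + c) (hM' : ∀ a b : M, a ≤ a + b)
    (x y : Diff M) : ∃ z, IsLUB {x, y} z := by
  obtain ⟨a, b, rfl⟩ := exists_mk x
  obtain ⟨c, d, rfl⟩ := exists_mk y
  have h1 : mk a b = mk (d + a) (b + d) := mk_eq_mk.2 (by abel)
  have h2 : mk c d = mk (b + c) (b + d) := mk_eq_mk.2 (by abel)
  refine ⟨mk ((d + a) ⊔ (b + c)) (b + d), ?_, ?_⟩
  · rintro z (rfl | rfl)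
    · rw [h1, mk_le_mk]; exact add_le_add_right le_sup_left _
    · rw [h2, mk_le_mk]; exact add_le_add_right le_sup_right _
  · intro z hz
    have hz1 := hz (Set.mem_insert _ _)
    have hz2 := hz (Set.mem_insert_of_mem _ rfl)
    obtain ⟨e, f, rfl⟩ := exists_mk z
    rw [h1, mk_le_mk] at hz1
    rw [h2, mk_le_mk] at hz2
    exact mk_le_mk.2 (sup_add_le hM hM' hz1 hz2)

/-- The group of differences is lattice-ordered. -/
noncomputable abbrev diffLattice (hM : ∀ a b : M, a ≤ b → ∃ c, b = a + c)
    (hM' : ∀ a b : M, a ≤ a + b) : Lattice (Diff M) where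
  __ := (inferInstance : PartialOrder (Diff M))
  sup x y := (exists_isLUB hM hM' x y).choose
  le_sup_left x y := (exists_isLUB hM hM' x y).choose_spec.1 (Set.mem_insert _ _)
  le_sup_right x y := (exists_isLUB hM hM' x y).choose_spec.1 (Set.mem_insert_of_mem _ rfl)
  sup_le x y z hx hy := (exists_isLUB hM hM' x y).choose_spec.2 (by
    rintro w (rfl | rfl)
    · exact hx
    · exact hy)
  inf x y := -(exists_isLUB hM hM' (-x) (-y)).choose
  inf_le_left x y :=
    neg_le.1 ((exists_isLUB hM hM' (-x) (-y)).choose_spec.1 (Set.mem_insert _ _))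
  inf_le_right x y :=
    neg_le.1 ((exists_isLUB hM hM' (-x) (-y)).choose_spec.1 (Set.mem_insert_of_mem _ rfl))
  le_inf x y z hx hy := le_neg.1 ((exists_isLUB hM hM' (-y) (-z)).choose_spec.2 (by
    rintro w (rfl | rfl)
    · exact neg_le_neg hx
    · exact neg_le_neg hy))

theorem exists_group (hM : ∀ a b : M, a ≤ b → ∃ c, b = a + c) (hM' : ∀ a b : M, a ≤ a + b) :
    ∃ (G : AbLatGroup.{u}) (e : M → {g : G // 0 ≤ g}), Function.Surjective e ∧
      (∀ a b, e (a + b) = e a + e b) ∧ ∀ a b, e a ≤ e b ↔ a ≤ b := by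
  let _ := diffLattice hM hM'
  have hpos : ∀ a : M, (0 : Diff M) ≤ mk a 0 := fun a => by
    rw [zero_eq, mk_le_mk]
    simpa using hM' 0 a
  refine ⟨{ carrier := Diff M }, fun a => ⟨mk a 0, hpos a⟩, ?_, ?_, ?_⟩
  · rintro ⟨x, hx⟩
    obtain ⟨a, b, rfl⟩ := exists_mk x
    rw [zero_eq] at hx
    have hx' : b + 0 ≤ 0 + a := hx
    rw [add_zero, zero_add] at hx'
    obtain ⟨c, rfl⟩ := hM b a hx'
    exact ⟨c, Subtype.ext (mk_eq_mk.2 (by abel))⟩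
  · intro a b
    refine Subtype.ext ?_
    change mk (a + b) 0 = mk a 0 + mk b 0
    rw [mk_add_mk, add_zero]
  · intro a b
    change 0 + a ≤ 0 + b ↔ a ≤ b
    rw [zero_add, zero_add]

end

theorem isCone_of {T : Type u} [AddCommMonoid T] [Lattice T] [OrderTop T] (P : AddSubmonoid T)
    (hP : ∀ x, x ∈ P ↔ x ≠ ⊤) (htop : ∀ x : T, ⊤ + x = ⊤)
    (hsup : ∀ x y, x ∈ P → y ∈ P → x ⊔ y ∈ P) (hinf : ∀ x y, x ∈ P → y ∈ P → x ⊓ y ∈ P)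
    (hle : ∀ x y : T, x ≤ y ↔ ∃ z, y = x + z)
    (hcancel : ∀ x y z, x ∈ P → y ∈ P → z ∈ P → x + y ≤ x + z → y ≤ z) :
    ∃ G : AbLatGroup.{u}, Nonempty (T ≃+o WithTop {g : G // 0 ≤ g}) := by
  classical
  let _ : Lattice P := Subtype.lattice (fun x y hx hy => hsup x y hx hy)
    (fun x y hx hy => hinf x y hx hy)
  have hadd : ∀ x y : P, x ≤ y → ∀ z : P, x + z ≤ y + z := by
    intro x y h z
    obtain ⟨w, hw⟩ := (hle x.1 y.1).1 h
    exact (hle (x + z).1 (y + z).1).2 ⟨w, by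
      change y.1 + z.1 = x.1 + z.1 + w
      rw [hw, add_right_comm]⟩
  have : IsOrderedCancelAddMonoid P :=
    { add_le_add_left := hadd
      le_of_add_le_add_left := fun x y z h => hcancel x.1 y.1 z.1 x.2 y.2 z.2 h }
  obtain ⟨G, e, hes, hea, hel⟩ := exists_group (M := P)
    (by
      intro a b h
      obtain ⟨w, hw⟩ := (hle a.1 b.1).1 h
      refine ⟨⟨w, (hP w).2 ?_⟩, Subtype.ext hw⟩
      rintro rfl
      rw [add_comm, htop] at hw
      exact (hP _).1 b.2 hw)
    (fun a b => (hle a.1 (a + b).1).2 ⟨b.1, rfl⟩)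
  let F : T → WithTop {g : G // 0 ≤ g} := fun x => if h : x = ⊤ then ⊤ else (e ⟨x, (hP x).2 h⟩ :)
  have Ftop : F ⊤ = ⊤ := dif_pos rfl
  have Fcoe : ∀ x : P, F x.1 = (e x : WithTop _) := fun x => dif_neg ((hP _).1 x.2)
  have hcases : ∀ x : T, x = ⊤ ∨ ∃ y : P, x = y.1 := fun x => by
    by_cases h : x = ⊤
    · exact Or.inl h
    · exact Or.inr ⟨⟨x, (hP x).2 h⟩, rfl⟩
  have Fle : ∀ x y, F x ≤ F y ↔ x ≤ y := by
    intro x y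
    rcases hcases y with rfl | ⟨y, rfl⟩
    · simp [Ftop]
    · rcases hcases x with rfl | ⟨x, rfl⟩
      · rw [Ftop, Fcoe, top_le_iff, top_le_iff]
        simpa using (hP _).1 y.2
      · rw [Fcoe, Fcoe, WithTop.coe_le_coe, hel]
        rfl
  have Fadd : ∀ x y, F (x + y) = F x + F y := by
    intro x y
    rcases hcases y with rfl | ⟨y, rfl⟩
    · rw [add_comm, htop, Ftop, WithTop.add_top]
    · rcases hcases x with rfl | ⟨x, rfl⟩
      · rw [htop, Ftop, WithTop.top_add]
      · have h := Fcoe (x + y)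
        rw [hea] at h
        rw [Fcoe, Fcoe, ← WithTop.coe_add]
        exact h
  have Finj : Function.Injective F := fun x y h =>
    le_antisymm ((Fle x y).1 h.le) ((Fle y x).1 h.ge)
  have Fsurj : Function.Surjective F := by
    intro z
    induction z with
    | top => exact ⟨⊤, Ftop⟩
    | coe z =>
      obtain ⟨x, rfl⟩ := hes z
      exact ⟨x.1, Fcoe x⟩
  exact ⟨G, ⟨{
    toEquiv := Equiv.ofBijective F ⟨Finj, Fsurj⟩
    map_add' := Fadd
    map_le_map_iff' := Fle _ _ }⟩⟩

end Cone

/-! ## The functor `θ` -/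

open MVAlgebra in
/-- `θ(A) = {x ∈ A | 2 x² ≤ x}`. -/
def thetaSubmonoid (A : Type u) [MVAlgebra A] [IsPerfect A] : AddSubmonoid A where
  carrier := {x | x ⊙ x + x ⊙ x ≤ x}
  zero_mem' := isInfinitesimal_zero.inTheta
  add_mem' := inTheta_add

/-- `θ(A)`, with the operations inherited from `A`. -/
abbrev Theta (A : Type u) [MVAlgebra A] [MVAlgebra.IsPerfect A] : Type u := thetaSubmonoid A

namespace Theta

open MVAlgebra

variable (A : Type u) [MVAlgebra A] [IsPerfect A]

instance : Lattice (Theta A) :=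
  Subtype.lattice (fun _ _ hx hy => inTheta_sup hx hy) (fun _ _ hx hy => inTheta_inf hx hy)

instance : OrderTop (Theta A) where
  top := ⟨1, inTheta_one⟩
  le_top x := le_one_mv x.1

variable {A} in
theorem ne_top_iff {x : Theta A} : x ≠ ⊤ ↔ IsInfinitesimal x.1 := by
  constructor
  · intro h
    rcases inTheta_iff.1 x.2 with h' | h'
    · exact h'
    · exact absurd (Subtype.ext h') h
  · rintro h rfl
    exact not_isInfinitesimal_one h

theorem isCone : ∃ G : AbLatGroup.{u}, Nonempty (Theta A ≃+o WithTop {g : G // 0 ≤ g}) := by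
  refine Cone.isCone_of
    { carrier := {x : Theta A | IsInfinitesimal x.1}
      zero_mem' := isInfinitesimal_zero
      add_mem' := fun hx hy => IsInfinitesimal.add hx hy }
    (fun x => ne_top_iff.symm) ?_ ?_ ?_ ?_ ?_
  · intro x
    refine Subtype.ext ?_
    change (1 : A) + x.1 = 1
    rw [add_comm, add_one']
  · exact fun x y hx hy => IsInfinitesimal.sup hx hy
  · exact fun x y hx hy => IsInfinitesimal.mono hx inf_le_left
  · intro x y
    constructor
    · intro h
      by_cases hy : y = ⊤
      · refine ⟨⊤, ?_⟩
        rw [hy]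
        refine Subtype.ext ?_
        change (1 : A) = x.1 + 1
        rw [add_one']
      · obtain ⟨z, hz⟩ := MVAlgebra.le_def.1 (show x.1 ≤ y.1 from h)
        have hz' : z ≤ y.1 := by rw [hz, add_comm]; exact le_add _ _
        exact ⟨⟨z, ((ne_top_iff.1 hy).mono hz').inTheta⟩, Subtype.ext hz⟩
    · rintro ⟨z, rfl⟩
      exact le_add x.1 z.1
  · intro x y z hx hy hz h
    have h1 := odot_mono (show x.1 + y.1 ≤ x.1 + z.1 from h) (le_refl x.1ᶜ)
    rw [add_odot_compl (odot_zero_iff.1 (IsInfinitesimal.odot hy hx)),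
      add_odot_compl (odot_zero_iff.1 (IsInfinitesimal.odot hz hx))] at h1
    exact h1

variable {A} in
/-- A homomorphism of perfect MV-algebras restricts to `θ`. -/
def map {B : Type u} [MVAlgebra B] [IsPerfect B] (f : MVHom A B) :
    ConeTopHom (Theta A) (Theta B) where
  toFun x := ⟨f x.1, f.map_inTheta x.2⟩
  map_zero' := Subtype.ext f.map_zero
  map_add' x y := Subtype.ext (f.map_add x.1 y.1)
  map_sup' x y := Subtype.ext (f.map_sup x.1 y.1)
  map_inf' x y := Subtype.ext (f.map_inf x.1 y.1)
  map_cone' x hx := ne_top_iff.2 (f.map_isInfinitesimal (ne_top_iff.1 hx))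
  map_top' := Subtype.ext f.map_one

end Theta

/-- The functor `θ` from perfect MV-algebras to `TOP`. -/
def thetaFunctor : PerfMV.{u} ⥤ ConeTop.{u} where
  obj A := { carrier := Theta A, isCone := Theta.isCone A }
  map f := Theta.map f

/-! ## The functor `Detrop` is an equivalence -/

namespace Detrop

open Classical in
/-- The extension by zero of a homomorphism between the groups of nonzero elements. -/
noncomputable def extend {S T : IdemSemifield.{u}} (f : LatGroupHom (Detrop S) (Detrop T)) :
    S →+* T where
  toFun x := if hx : x = 0 then 0 else (f ⟨x, hx⟩).val
  map_zero' := dif_pos rfl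
  map_one' := (dif_neg one_ne_zero).trans (congrArg Detrop.val f.map_zero)
  map_mul' x y := by
    by_cases hx : x = 0
    · simp [hx]
    by_cases hy : y = 0
    · simp [hy]
    rw [dif_neg (mul_ne_zero hx hy), dif_neg hx, dif_neg hy]
    exact congrArg Detrop.val (f.map_add ⟨x, hx⟩ ⟨y, hy⟩)
  map_add' x y := by
    by_cases hx : x = 0
    · simp [hx]
    by_cases hy : y = 0
    · simp [hy]
    rw [dif_neg (add_ne_zero S hx), dif_neg hx, dif_neg hy]
    exact congrArg Detrop.val (f.map_sup ⟨x, hx⟩ ⟨y, hy⟩)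

theorem extend_val {S T : IdemSemifield.{u}} (f : LatGroupHom (Detrop S) (Detrop T))
    (x : Detrop S) : extend f x.val = (f x).val := dif_neg x.ne_zero

end Detrop

/-- The semifield `G ∪ {0}` of an abelian lattice-ordered group `G`: the product is the sum of `G`
and the sum is the supremum. -/
abbrev Trop (G : Type u) : Type u := WithZero (Multiplicative G)

namespace Trop

variable {G : Type u}

instance [Lattice G] : Add (Trop G) where
  add x y := match x, y with
    | none, y => y
    | some x, none => some x
    | some x, some y => some (Multiplicative.ofAdd (x.toAdd ⊔ y.toAdd))

/-- The nonzero element of `Trop G` given by `g`. -/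
def ofGroup (g : G) : Trop G := ((Multiplicative.ofAdd g : Multiplicative G) : WithZero _)

theorem cases (x : Trop G) : x = 0 ∨ ∃ g, x = ofGroup g := by
  induction x using WithZero.recZeroCoe with
  | zero => exact Or.inl rfl
  | coe a => exact Or.inr ⟨a.toAdd, rfl⟩

theorem ofGroup_ne_zero (g : G) : ofGroup g ≠ 0 := WithZero.coe_ne_zero

theorem ofGroup_injective : Function.Injective (ofGroup (G := G)) := fun _ _ h =>
  Multiplicative.ofAdd.injective (WithZero.coe_injective h)

section

variable [Lattice G]

theorem ofGroup_add (g h : G) : ofGroup g + ofGroup h = ofGroup (g ⊔ h) := rfl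

protected theorem zero_add (x : Trop G) : 0 + x = x := rfl

protected theorem add_zero (x : Trop G) : x + 0 = x := by
  rcases cases x with rfl | ⟨g, rfl⟩ <;> rfl

end

theorem ofGroup_mul [AddCommGroup G] (g h : G) : ofGroup g * ofGroup h = ofGroup (g + h) := rfl

noncomputable instance [AddCommGroup G] [Lattice G] [IsOrderedAddMonoid G] :
    Semifield (Trop G) where
  __ := (inferInstance : CommGroupWithZero (Trop G))
  zero_add := Trop.zero_add
  add_zero := Trop.add_zero
  add_comm x y := by
    rcases cases x with rfl | ⟨a, rfl⟩
    · rw [Trop.zero_add, Trop.add_zero]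
    rcases cases y with rfl | ⟨b, rfl⟩
    · rw [Trop.zero_add, Trop.add_zero]
    rw [ofGroup_add, ofGroup_add, sup_comm]
  add_assoc x y z := by
    rcases cases x with rfl | ⟨a, rfl⟩
    · rw [Trop.zero_add, Trop.zero_add]
    rcases cases y with rfl | ⟨b, rfl⟩
    · rw [Trop.zero_add, Trop.add_zero]
    rcases cases z with rfl | ⟨c, rfl⟩
    · rw [Trop.add_zero, Trop.add_zero]
    simp only [ofGroup_add, sup_assoc]
  left_distrib x y z := by
    rcases cases x with rfl | ⟨a, rfl⟩
    · rw [zero_mul, zero_mul, zero_mul, Trop.zero_add]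
    rcases cases y with rfl | ⟨b, rfl⟩
    · rw [mul_zero, Trop.zero_add, Trop.zero_add]
    rcases cases z with rfl | ⟨c, rfl⟩
    · rw [mul_zero, Trop.add_zero, Trop.add_zero]
    simp only [ofGroup_add, ofGroup_mul, add_sup]
  right_distrib x y z := by
    rcases cases z with rfl | ⟨a, rfl⟩
    · rw [mul_zero, mul_zero, mul_zero, Trop.zero_add]
    rcases cases x with rfl | ⟨b, rfl⟩
    · rw [zero_mul, Trop.zero_add, Trop.zero_add]
    rcases cases y with rfl | ⟨c, rfl⟩
    · rw [zero_mul, Trop.add_zero, Trop.add_zero]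
    simp only [ofGroup_add, ofGroup_mul, sup_add]
  nsmul := nsmulRec
  nnqsmul := _
  nnqsmul_def _ _ := rfl

/-- `G ∪ {0}` as an object of the category of additively idempotent semifields. -/
noncomputable def of (G : AbLatGroup.{u}) : IdemSemifield.{u} where
  carrier := Trop G
  add_self x := by
    rcases cases x with rfl | ⟨a, rfl⟩
    · rfl
    · rw [ofGroup_add, sup_idem]

end Trop

namespace LatGroupHom

/-- The inverse of a bijective homomorphism. -/
noncomputable def symm {G H : Type*} [AddCommGroup G] [Lattice G] [AddCommGroup H] [Lattice H]
    (f : LatGroupHom G H) (hf : Function.Bijective f) : LatGroupHom H G where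
  __ := (AddEquiv.ofBijective f.toAddMonoidHom hf).symm.toAddMonoidHom
  map_sup' x y := by
    let e := AddEquiv.ofBijective f.toAddMonoidHom hf
    refine e.injective ((e.apply_symm_apply _).trans (Eq.symm ?_))
    exact (f.map_sup _ _).trans (congrArg₂ _ (e.apply_symm_apply x) (e.apply_symm_apply y))
  map_inf' x y := by
    let e := AddEquiv.ofBijective f.toAddMonoidHom hf
    refine e.injective ((e.apply_symm_apply _).trans (Eq.symm ?_))
    exact (f.map_inf _ _).trans (congrArg₂ _ (e.apply_symm_apply x) (e.apply_symm_apply y))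

end LatGroupHom

/-- A bijective homomorphism is an isomorphism of abelian lattice-ordered groups. -/
noncomputable def AbLatGroup.isoOfBijective {G H : AbLatGroup.{u}} (f : LatGroupHom G H)
    (hf : Function.Bijective f) : G ≅ H where
  hom := f
  inv := f.symm hf
  hom_inv_id := LatGroupHom.ext
    (funext (AddEquiv.ofBijective f.toAddMonoidHom hf).symm_apply_apply)
  inv_hom_id := LatGroupHom.ext
    (funext (AddEquiv.ofBijective f.toAddMonoidHom hf).apply_symm_apply)

/-- The nonzero elements of `G ∪ {0}` are those of `G`. -/
def Trop.toDetrop (G : AbLatGroup.{u}) : LatGroupHom G (Detrop (Trop.of G)) where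
  toFun g := ⟨ofGroup g, ofGroup_ne_zero g⟩
  map_zero' := rfl
  map_add' _ _ := rfl
  map_sup' _ _ := rfl
  map_inf' x y := Detrop.ext (by
    change ofGroup (x ⊓ y) = ofGroup (-(-x ⊔ -y))
    rw [neg_sup, neg_neg, neg_neg])

theorem Trop.toDetrop_bijective (G : AbLatGroup.{u}) : Function.Bijective (toDetrop G) := by
  constructor
  · intro g h hgh
    exact ofGroup_injective (congrArg Detrop.val hgh)
  · rintro ⟨x, hx⟩
    rcases Trop.cases x with rfl | ⟨g, rfl⟩
    · exact absurd rfl hx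
    · exact ⟨g, rfl⟩

instance detropFunctor_faithful : detropFunctor.{u}.Faithful where
  map_injective {S T} f g h := by
    refine RingHom.ext fun x => ?_
    by_cases hx : x = 0
    · rw [hx]
      exact (RingHom.map_zero f).trans (RingHom.map_zero g).symm
    · exact congrArg Detrop.val (DFunLike.congr_fun (F := LatGroupHom (Detrop S) (Detrop T)) h
        ⟨x, hx⟩)

instance detropFunctor_full : detropFunctor.{u}.Full where
  map_surjective f :=
    ⟨Detrop.extend f, LatGroupHom.ext (funext fun x => Detrop.ext (Detrop.extend_val f x))⟩

instance detropFunctor_essSurj : detropFunctor.{u}.EssSurj where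
  mem_essImage G :=
    ⟨Trop.of G, ⟨(AbLatGroup.isoOfBijective _ (Trop.toDetrop_bijective G)).symm⟩⟩

instance detropFunctor_isEquivalence : detropFunctor.{u}.IsEquivalence where


/-! ## The composite of `Δ` and `θ` is an equivalence -/

namespace LatGroupHom

section Extend

variable {G H : Type*} [AddCommGroup G] [Lattice G] [IsOrderedAddMonoid G] [AddCommGroup H]
  [Lattice H]

/-- A homomorphism of abelian lattice-ordered groups is determined by its values on the positive
cone. -/
theorem ext_of_nonneg {f g : LatGroupHom G H} (h : ∀ x, 0 ≤ x → f x = g x) : f = g := by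
  refine LatGroupHom.ext (funext fun x => ?_)
  change f x = g x
  rw [← posPart_sub_negPart x, f.map_sub, g.map_sub, h _ (posPart_nonneg x),
    h _ (negPart_nonneg x)]

variable [IsOrderedAddMonoid H]

/-- A map preserving `+` and `⊔` on the positive cone extends to a homomorphism of lattice-ordered
groups. -/
theorem exists_extend (k : G → H) (hadd : ∀ x y, 0 ≤ x → 0 ≤ y → k (x + y) = k x + k y)
    (hsup : ∀ x y, 0 ≤ x → 0 ≤ y → k (x ⊔ y) = k x ⊔ k y) :
    ∃ f : LatGroupHom G H, ∀ x, 0 ≤ x → f x = k x := by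
  have key : ∀ a b, 0 ≤ a → 0 ≤ b → k (a - b)⁺ - k (a - b)⁻ = k a - k b := by
    intro a b ha hb
    have h : (a - b)⁺ + b = a + (a - b)⁻ := by
      rw [← sub_eq_sub_iff_add_eq_add, posPart_sub_negPart]
    rw [sub_eq_sub_iff_add_eq_add, ← hadd _ _ (posPart_nonneg _) hb,
      ← hadd _ _ ha (negPart_nonneg _), h]
  have k0 : k 0 = 0 := by
    have := hadd 0 0 le_rfl le_rfl
    rwa [add_zero, left_eq_add] at this
  let f : G →+ H := AddMonoidHom.mk' (fun x => k x⁺ - k x⁻) (by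
    intro x y
    have h : x + y = (x⁺ + y⁺) - (x⁻ + y⁻) := by
      rw [add_sub_add_comm, posPart_sub_negPart, posPart_sub_negPart]
    rw [h, key _ _ (add_nonneg (posPart_nonneg _) (posPart_nonneg _))
      (add_nonneg (negPart_nonneg _) (negPart_nonneg _)),
      hadd _ _ (posPart_nonneg _) (posPart_nonneg _),
      hadd _ _ (negPart_nonneg _) (negPart_nonneg _), add_sub_add_comm])
  have hf : ∀ x, 0 ≤ x → f x = k x := fun x hx => by
    have := key x 0 hx le_rfl
    rwa [sub_zero, k0, sub_zero] at this
  have fsup : ∀ x y, f (x ⊔ y) = f x ⊔ f y := by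
    intro x y
    have hx : 0 ≤ x + (x⁻ + y⁻) := neg_le_iff_add_nonneg'.1
      (le_add_of_le_of_nonneg (neg_le_negPart x) (negPart_nonneg y))
    have hy : 0 ≤ y + (x⁻ + y⁻) := neg_le_iff_add_nonneg'.1
      (le_add_of_nonneg_of_le (negPart_nonneg x) (neg_le_negPart y))
    have h := hsup _ _ hx hy
    rw [← hf _ hx, ← hf _ hy, ← hf _ (hx.trans le_sup_left), ← sup_add, map_add, f.map_add _ (x⁻ + y⁻),
      f.map_add y (x⁻ + y⁻), ← sup_add] at h
    exact add_right_cancel h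
  refine ⟨{ f with map_sup' := fsup, map_inf' := fun x y => ?_ }, hf⟩
  have h : ∀ a b : G, a ⊓ b = -(-a ⊔ -b) := fun a b => by rw [neg_sup, neg_neg, neg_neg]
  change f (x ⊓ y) = f x ⊓ f y
  rw [h, map_neg, fsup, map_neg, map_neg, neg_sup, neg_neg, neg_neg]

end Extend

end LatGroupHom

/-- An isomorphism of ordered monoids is a morphism of `TOP`. -/
def ConeTopHom.ofOrderAddIso {S T : Type*} [AddCommMonoid S] [Lattice S] [OrderTop S]
    [AddCommMonoid T] [Lattice T] [OrderTop T] (e : S ≃+o T) : ConeTopHom S T where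
  __ := e.toAddEquiv.toAddMonoidHom
  map_sup' x y := map_sup e.toOrderIso x y
  map_inf' x y := map_inf e.toOrderIso x y
  map_cone' _ hx h := hx ((map_eq_top_iff e.toOrderIso).1 h)
  map_top' := map_top e.toOrderIso

/-- An isomorphism of ordered monoids is an isomorphism of `TOP`. -/
def ConeTop.isoOfOrderAddIso {S T : ConeTop.{u}} (e : S ≃+o T) : S ≅ T where
  hom := ConeTopHom.ofOrderAddIso e
  inv := ConeTopHom.ofOrderAddIso e.symm
  hom_inv_id := ConeTopHom.ext (funext e.symm_apply_apply)
  inv_hom_id := ConeTopHom.ext (funext e.apply_symm_apply)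

namespace Delta

open MVAlgebra

variable {G : Type u} [AddCommGroup G] [Lattice G] [IsOrderedAddMonoid G]

/-- The element `(0, g)` of `Δ(G)`. -/
def ofPos (g : G) (hg : 0 ≤ g) : Delta G where
  val := toLex (0, g)
  nonneg := LexInt.le_iff.2 (Or.inr ⟨rfl, hg⟩)
  le := LexInt.le_iff.2 (Or.inl one_pos)

/-- The element `(0, g)` of `θ(Δ(G))`. -/
def posTheta (g : G) (hg : 0 ≤ g) : Theta (Delta G) :=
  ⟨ofPos g hg, ((isInfinitesimal_iff (ofPos g hg)).2 rfl).inTheta⟩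

theorem posTheta_ne_top (g : G) (hg : 0 ≤ g) : posTheta g hg ≠ ⊤ :=
  Theta.ne_top_iff.2 ((isInfinitesimal_iff (ofPos g hg)).2 rfl)

theorem exists_posTheta {x : Theta (Delta G)} (hx : x ≠ ⊤) : ∃ g hg, x = posTheta g hg := by
  have h := (isInfinitesimal_iff x.1).1 (Theta.ne_top_iff.1 hx)
  refine ⟨(ofLex x.1.val).2, ?_, ?_⟩
  · rcases LexInt.le_iff.1 x.1.nonneg with h' | h'
    · exact absurd (h'.trans_eq h) (lt_irrefl 0)
    · exact h'.2
  · exact Subtype.ext (Gamma.ext (congrArg toLex (Prod.ext h rfl)))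

theorem posTheta_inj {g h : G} {hg : 0 ≤ g} {hh : 0 ≤ h} :
    posTheta g hg = posTheta h hh ↔ g = h := by
  constructor
  · intro e
    exact congrArg (fun x : Theta (Delta G) => (ofLex x.1.val).2) e
  · rintro rfl
    rfl

theorem posTheta_le {g h : G} {hg : 0 ≤ g} {hh : 0 ≤ h} :
    posTheta g hg ≤ posTheta h hh ↔ g ≤ h := by
  refine (Gamma.le_iff_val (x := ofPos g hg) (y := ofPos h hh)).trans (LexInt.le_iff.trans ?_)
  simp [ofPos]

theorem posTheta_add {g h : G} (hg : 0 ≤ g) (hh : 0 ≤ h) :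
    posTheta g hg + posTheta h hh = posTheta (g + h) (add_nonneg hg hh) := by
  refine Subtype.ext (Gamma.ext ?_)
  exact inf_eq_left.2 (LexInt.le_iff.2 (Or.inl one_pos))

theorem posTheta_sup {g h : G} (hg : 0 ≤ g) (hh : 0 ≤ h) :
    posTheta g hg ⊔ posTheta h hh = posTheta (g ⊔ h) (hg.trans le_sup_left) := by
  refine le_antisymm (sup_le (posTheta_le.2 le_sup_left) (posTheta_le.2 le_sup_right)) ?_
  have hne : posTheta g hg ⊔ posTheta h hh ≠ ⊤ := fun e => by
    refine posTheta_ne_top (g ⊔ h) (hg.trans le_sup_left) (top_le_iff.1 (e.symm.trans_le ?_))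
    exact sup_le (posTheta_le.2 le_sup_left) (posTheta_le.2 le_sup_right)
  obtain ⟨z, hz, e⟩ := exists_posTheta hne
  rw [e, posTheta_le]
  exact sup_le (posTheta_le.1 (le_sup_left.trans_eq e)) (posTheta_le.1 (le_sup_right.trans_eq e))

/-- The bijection from `G⁺ ∪ {⊤}` to `θ(Δ(G))`. -/
noncomputable def coneMap : WithTop {g : G // 0 ≤ g} → Theta (Delta G)
  | ⊤ => ⊤
  | WithTop.some g => posTheta g.1 g.2

theorem coneMap_le (x y : WithTop {g : G // 0 ≤ g}) : coneMap x ≤ coneMap y ↔ x ≤ y := by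
  induction y with
  | top => exact iff_of_true le_top le_top
  | coe y =>
    induction x with
    | top => exact iff_of_false (fun h => posTheta_ne_top _ _ (top_le_iff.1 h)) (by simp)
    | coe x => exact posTheta_le.trans (WithTop.coe_le_coe (a := y) (b := x)).symm

theorem coneMap_add (x y : WithTop {g : G // 0 ≤ g}) :
    coneMap (x + y) = coneMap x + coneMap y := by
  have htop : ∀ z : Theta (Delta G), z + ⊤ = ⊤ := fun z => Subtype.ext (add_one' z.1)
  induction y with
  | top => rw [WithTop.add_top]; exact (htop _).symm
  | coe y =>
    induction x with
    | top => rw [WithTop.top_add, add_comm]; exact (htop _).symm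
    | coe x => exact (posTheta_add x.2 y.2).symm

theorem coneMap_bijective : Function.Bijective (coneMap (G := G)) := by
  constructor
  · exact fun x y h => le_antisymm ((coneMap_le x y).1 h.le) ((coneMap_le y x).1 h.ge)
  · intro x
    by_cases hx : x = ⊤
    · exact ⟨⊤, hx.symm⟩
    · obtain ⟨g, hg, rfl⟩ := exists_posTheta hx
      exact ⟨((⟨g, hg⟩ : {g : G // 0 ≤ g}) : WithTop _), rfl⟩

/-- `θ(Δ(G))` is isomorphic to `G⁺ ∪ {⊤}`. -/
noncomputable def coneIso : WithTop {g : G // 0 ≤ g} ≃+o Theta (Delta G) where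
  toEquiv := Equiv.ofBijective coneMap coneMap_bijective
  map_add' := coneMap_add
  map_le_map_iff' := coneMap_le _ _

/-- The functorial image of `f` under `Δ` and `θ`. -/
noncomputable def thetaMap {H : Type u} [AddCommGroup H] [Lattice H] [IsOrderedAddMonoid H]
    (f : LatGroupHom G H) : ConeTopHom (Theta (Delta G)) (Theta (Delta H)) :=
  Theta.map (Gamma.map (LexInt.map f) (LexInt.map_unit f))

theorem thetaMap_surjective {H : Type u} [AddCommGroup H] [Lattice H] [IsOrderedAddMonoid H]
    (φ : ConeTopHom (Theta (Delta G)) (Theta (Delta H))) : ∃ f, thetaMap f = φ := by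
  have hφ : ∀ x : G, ∃ y : H, ∀ hx : 0 ≤ x, ∃ hy, φ (posTheta x hx) = posTheta y hy := by
    intro x
    by_cases hx : 0 ≤ x
    · obtain ⟨y, hy, e⟩ := exists_posTheta (φ.map_cone' _ (posTheta_ne_top x hx))
      exact ⟨y, fun _ => ⟨hy, e⟩⟩
    · exact ⟨0, fun h => absurd h hx⟩
  choose k hk using hφ
  obtain ⟨f, hf⟩ := LatGroupHom.exists_extend k
    (by
      intro x y hx hy
      obtain ⟨h1, e1⟩ := hk x hx
      obtain ⟨h2, e2⟩ := hk y hy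
      obtain ⟨h3, e3⟩ := hk _ (add_nonneg hx hy)
      refine (posTheta_inj (hg := h3) (hh := add_nonneg h1 h2)).1 ?_
      rw [← e3, ← posTheta_add h1 h2, ← e1, ← e2, ← posTheta_add hx hy]
      exact φ.map_add' _ _)
    (by
      intro x y hx hy
      obtain ⟨h1, e1⟩ := hk x hx
      obtain ⟨h2, e2⟩ := hk y hy
      obtain ⟨h3, e3⟩ := hk _ (hx.trans (le_sup_left (b := y)))
      refine (posTheta_inj (hg := h3) (hh := h1.trans le_sup_left)).1 ?_
      rw [← e3, ← posTheta_sup h1 h2, ← e1, ← e2, ← posTheta_sup hx hy]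
      exact φ.map_sup' _ _)
  refine ⟨f, ConeTopHom.ext (funext fun x => ?_)⟩
  by_cases hx : x = ⊤
  · rw [hx]
    exact (thetaMap f).map_top'.trans
      φ.map_top'.symm
  · obtain ⟨g, hg, rfl⟩ := exists_posTheta hx
    obtain ⟨h, e⟩ := hk g hg
    refine Eq.trans (Subtype.ext (Gamma.ext ?_)) e.symm
    exact congrArg (fun y => toLex ((0 : ℤ), y)) (hf g hg)

end Delta

open Delta

instance deltaTheta_faithful : (deltaFunctor.{u} ⋙ thetaFunctor.{u}).Faithful where
  map_injective {G H} f g h := by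
    refine LatGroupHom.ext_of_nonneg fun x hx => ?_
    have := DFunLike.congr_fun (F := ConeTopHom (Theta (Delta G)) (Theta (Delta H))) h
      (posTheta x hx)
    exact congrArg (fun x : Theta (Delta H) => (ofLex x.1.val).2) this

instance deltaTheta_full : (deltaFunctor.{u} ⋙ thetaFunctor.{u}).Full where
  map_surjective {G H} φ := by
    obtain ⟨f, rfl⟩ := thetaMap_surjective (G := G) (H := H) φ
    exact ⟨f, rfl⟩

instance deltaTheta_essSurj : (deltaFunctor.{u} ⋙ thetaFunctor.{u}).EssSurj where
  mem_essImage T := by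
    obtain ⟨G, ⟨e⟩⟩ := T.isCone
    exact ⟨G, ⟨ConeTop.isoOfOrderAddIso
      (S := (deltaFunctor ⋙ thetaFunctor).obj G) (coneIso.symm.trans e.symm)⟩⟩

instance deltaTheta_isEquivalence : (deltaFunctor.{u} ⋙ thetaFunctor.{u}).IsEquivalence where

theorem mainTheorem3 :
    (detropFunctor.{u} ⋙ deltaFunctor.{u} ⋙ thetaFunctor.{u}).IsEquivalence := by
  infer_instance
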